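/- Let $a_1,\delta,\varepsilon,c_1>0$ and let $a_2,B,\beta_0,m$ be real numbers. Then there is an $N_0$, depending only on these numbers, such that the following holds for every integer $N\ge N_0$. Let levels $i=1,\dots,s$ be given with values $\lambda_i\in[0,B]$ and multiplicities $q_i\in\{0,1,2,\dots\}$, and let $Q=\sum_{i=1}^s q_i$ satisfy $a_1N\le Q\le a_2N$. A variant assigns a nonnegative integer to each of the $q_i$ states of each level $i$; let $N_i$ be the sum of these integers over the states of level $i$ (if all $q_i=1$, then $Q=s$ and a variant is just a sequence $N_1,\dots,N_s$ of nonnegative integers). For a real number $E$ let $\mathcal M$ be the set of all variants with $$\sum_{i=1}^s N_i=N,\qquad \sum_{i=1}^s\lambda_iN_i\le E ,$$ all of them taken as equiprobable, and let $\mathcal N\{\mathcal M\}$ be their number. Let $\beta'\in[0,\beta_0]$ and $\nu'$ be real numbers with $\beta'\lambda_i-\nu'>0$ for all $i$ and $$\sum_{i=1}^s\frac{q_i}{e^{\beta'\lambda_i-\nu'}-1}=N,\qquad \sum_{i=1}^s\frac{\lambda_iq_i}{e^{\beta'\lambda_i-\nu'}-1}=E,$$ where for $\beta'=0$ the last equality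 may be replaced by $\le E$. Assume that $e^{\beta_0B}<1+a_1$ or that $\beta'\lambda_i-\nu'\ge\delta$ for all $i$. Then for every $l$ with $\sum_{i=1}^l q_i\ge\varepsilon Q$ the number of variants in $\mathcal M$ with $$\Bigl|\sum_{i=1}^lN_i-\sum_{i=1}^l\frac{q_i}{e^{\beta'\lambda_i-\nu'}-1}\Bigr|\ge N^{3/4+\varepsilon}$$ is less than $c_1\,\mathcal N\{\mathcal M\}/N^m$. -/

import Mathlib

namespace OperationalRisk

/-- A variant: level `i` (for `i = 1, …, s`) has multiplicity `q i`, i.e. it consists of `q i`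
states, and a variant assigns a nonnegative integer to every state of every level. If all
multiplicities are `1`, a variant is just a sequence `N_1, …, N_s` of nonnegative integers. -/
abbrev Variant {s : ℕ} (q : Fin s → ℕ) : Type := (Σ i : Fin s, Fin (q i)) → ℕ

/-- The number `N_i` of a variant: the total over the `q i` states of level `i`. -/
def levelNumber {s : ℕ} {q : Fin s → ℕ} (n : Variant q) (i : Fin s) : ℕ :=
  ∑ k : Fin (q i), n ⟨i, k⟩

/-- The set `𝓜` of the variants with `∑ N_i = N` and `∑ λ_i N_i ≤ E`. -/
def admissible {s : ℕ} (q : Fin s → ℕ) (lam : Fin s → ℝ) (N : ℕ) (E : ℝ) : Set (Variant q) :=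
  {n | ∑ i, levelNumber n i = N ∧ ∑ i, lam i * (levelNumber n i : ℝ) ≤ E}

/-- The Bose–Einstein value `q_i / (exp (β λ_i - ν) - 1)`. -/
noncomputable def boseEinstein {s : ℕ} (q : Fin s → ℕ) (lam : Fin s → ℝ) (β ν : ℝ)
    (i : Fin s) : ℝ :=
  (q i : ℝ) / (Real.exp (β * lam i - ν) - 1)

/-- The indices of the first `l` levels. -/
def firstLevels (s l : ℕ) : Finset (Fin s) := Finset.univ.filter fun i => (i : ℕ) < l

/-- The admissible variants whose partial sum `∑_{i ≤ l} N_i` deviates from the Bose–Einstein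
partial sum by at least `Δ`. -/
def deviating {s : ℕ} (q : Fin s → ℕ) (lam : Fin s → ℝ) (N : ℕ) (E β ν : ℝ) (l : ℕ) (Δ : ℝ) :
    Set (Variant q) :=
  {n ∈ admissible q lam N E |
    Δ ≤ |∑ i ∈ firstLevels s l, (levelNumber n i : ℝ) -
      ∑ i ∈ firstLevels s l, boseEinstein q lam β ν i|}

/-- There are finitely many admissible variants, so that `Set.ncard` counts them. -/
theorem admissible_finite {s : ℕ} (q : Fin s → ℕ) (lam : Fin s → ℝ) (N : ℕ) (E : ℝ) :
    (admissible q lam N E).Finite := by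
  refine (Set.finite_Iic (fun _ => N : Variant q)).subset ?_
  rintro n ⟨h, -⟩ ⟨i, k⟩
  calc n ⟨i, k⟩ ≤ levelNumber n i :=
        Finset.single_le_sum (f := fun k => n ⟨i, k⟩) (fun _ _ => Nat.zero_le _)
          (Finset.mem_univ k)
    _ ≤ ∑ i, levelNumber n i :=
        Finset.single_le_sum (f := fun i => levelNumber n i) (fun _ _ => Nat.zero_le _)
          (Finset.mem_univ i)
    _ = N := h

end OperationalRisk

/-! Give each state an independent geometric number of particles whose mean is its Bose–Einstein
value, and let `S` be the entropy of this law. Every admissible pattern then has probability at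
least `exp (-S)`, so Chernoff's bound with parameter `N ^ (-1 / 4)` leaves at most
`exp (S + O(√N) - N ^ (1 / 2 + ε))` admissible patterns with a deviation of `N ^ (3 / 4 + ε)`.

Conversely, empty `O(√N)` states of highest energy. With probability at least `1 / 4` the
fluctuations of the other states use up neither the particles nor the energy so released, and the
missing particles can be put into a state of lowest energy. As each resulting pattern has
probability at most `exp (-S + O(√N))`, there are at least `exp (S - O(√N))` admissible
patterns. -/

namespace OperationalRisk

open Filter MeasureTheory ProbabilityTheory Real

section Geometric

/-- A variance proxy `K` for a centred geometric variable `X` of mean at most `b`: the moment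
generating function satisfies `𝔼[exp (θ X)] ≤ exp (K θ²)` as long as `(1 + 4 b) |θ| ≤ 1`. -/
noncomputable def varianceProxy (b : ℝ) : ℝ := b + 8 * b ^ 2

theorem varianceProxy_nonneg {b : ℝ} (hb : 0 ≤ b) : 0 ≤ varianceProxy b := by
  unfold varianceProxy
  positivity

theorem inv_one_sub_le_exp {y : ℝ} (hy : y ≤ 1 / 2) : (1 - y)⁻¹ ≤ exp (y + 2 * y ^ 2) := by
  rw [inv_le_iff_one_le_mul₀ (by linarith)]
  nlinarith [mul_le_mul_of_nonneg_right (add_one_le_exp (y + 2 * y ^ 2))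
    (by linarith : 0 ≤ 1 - y), mul_nonneg (sq_nonneg y) (by linarith : 0 ≤ 1 - 2 * y)]

theorem abs_mul_exp_sub_one_le {m b θ : ℝ} (hm : 0 ≤ m) (hb : m ≤ b) (hθ : |θ| ≤ 1) :
    |m * (exp θ - 1)| ≤ 2 * b * |θ| :=
  calc |m * (exp θ - 1)| = m * |exp θ - 1| := by rw [abs_mul, abs_of_nonneg hm]
    _ ≤ b * (2 * |θ|) := by
      gcongr
      · exact hm.trans hb
      · exact abs_exp_sub_one_le hθ
    _ = 2 * b * |θ| := by ring

theorem mul_exp_sub_one_add_sq_le {m b θ : ℝ} (hm : 0 ≤ m) (hb : m ≤ b) (hθ : |θ| ≤ 1) :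
    m * (exp θ - 1) + 2 * (m * (exp θ - 1)) ^ 2 ≤ θ * m + varianceProxy b * θ ^ 2 := by
  have hsq : (m * (exp θ - 1)) ^ 2 ≤ 4 * b ^ 2 * θ ^ 2 :=
    calc (m * (exp θ - 1)) ^ 2 ≤ (2 * b * |θ|) ^ 2 :=
          sq_le_sq.2 ((abs_mul_exp_sub_one_le hm hb hθ).trans (le_abs_self _))
      _ = 4 * b ^ 2 * θ ^ 2 := by rw [mul_pow, sq_abs]; ring
  have hlin : m * (exp θ - 1 - θ) ≤ b * θ ^ 2 :=
    calc m * (exp θ - 1 - θ) ≤ m * θ ^ 2 := by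
          gcongr
          exact (le_abs_self _).trans (abs_exp_sub_one_sub_id_le hθ)
      _ ≤ b * θ ^ 2 := by gcongr
  unfold varianceProxy
  linarith

variable {p : unitInterval} {θ b : ℝ}

theorem hasSum_geometric_mul_exp (hp : p ≠ 0) (hθ : (1 - p : ℝ) / p * (exp θ - 1) < 1) :
    HasSum (fun n : ℕ => (1 - p : ℝ) ^ n * p * exp (θ * n))
      (1 - (1 - p : ℝ) / p * (exp θ - 1))⁻¹ := by
  have hp0 : 0 < (p : ℝ) := unitInterval.pos_iff_ne_zero.2 hp
  have hr : (1 - p : ℝ) * exp θ < 1 := by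
    rw [div_mul_eq_mul_div, div_lt_one hp0] at hθ
    linarith
  have hsum := (hasSum_geometric_of_lt_one
    (mul_nonneg (sub_nonneg.2 p.2.2) (exp_pos θ).le) hr).mul_left (p : ℝ)
  convert! hsum using 1
  · funext n
    rw [mul_pow, ← exp_nat_mul, mul_comm θ]
    ring
  · rw [← div_eq_mul_inv, inv_eq_iff_eq_inv, inv_div, eq_div_iff hp0.ne']
    field_simp
    ring

theorem integrable_exp_mul_geometricMeasure (hp : p ≠ 0)
    (hθ : (1 - p : ℝ) / p * (exp θ - 1) < 1) :
    Integrable (fun n : ℕ => exp (θ * n)) (geometricMeasure p) := by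
  rw [integrable_geometricMeasure_iff hp]
  simpa only [norm_eq_abs, abs_exp] using (hasSum_geometric_mul_exp hp hθ).summable

theorem mgf_geometricMeasure (hp : p ≠ 0) (hθ : (1 - p : ℝ) / p * (exp θ - 1) < 1) :
    mgf (fun n : ℕ => (n : ℝ)) (geometricMeasure p) θ =
      (1 - (1 - p : ℝ) / p * (exp θ - 1))⁻¹ := by
  rw [mgf, integral_geometricMeasure hp]
  simpa only [smul_eq_mul] using (hasSum_geometric_mul_exp hp hθ).tsum_eq

theorem geometric_mean_mul_exp_sub_one_le_half (hb : (1 - p : ℝ) / p ≤ b)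
    (hθ : (1 + 4 * b) * |θ| ≤ 1) : (1 - p : ℝ) / p * (exp θ - 1) ≤ 1 / 2 := by
  have hm : 0 ≤ (1 - p : ℝ) / p := div_nonneg (sub_nonneg.2 p.2.2) p.2.1
  have hbθ : 0 ≤ b * |θ| := mul_nonneg (hm.trans hb) (abs_nonneg θ)
  have hle := abs_mul_exp_sub_one_le hm hb (θ := θ) (by linarith)
  linarith [le_abs_self ((1 - p : ℝ) / p * (exp θ - 1)), abs_nonneg θ]

theorem integrable_exp_mul_sub_mean_geometricMeasure (hp : p ≠ 0) (hb : (1 - p : ℝ) / p ≤ b)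
    (hθ : (1 + 4 * b) * |θ| ≤ 1) :
    Integrable (fun n : ℕ => exp (θ * (n - (1 - p : ℝ) / p))) (geometricMeasure p) := by
  have hlt := (geometric_mean_mul_exp_sub_one_le_half hb hθ).trans_lt one_half_lt_one
  simpa only [mul_sub, exp_sub] using (integrable_exp_mul_geometricMeasure hp hlt).div_const _

theorem mgf_sub_mean_geometricMeasure_le (hp : p ≠ 0) (hb : (1 - p : ℝ) / p ≤ b)
    (hθ : (1 + 4 * b) * |θ| ≤ 1) :
    mgf (fun n : ℕ => (n - (1 - p : ℝ) / p : ℝ)) (geometricMeasure p) θ ≤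
      exp (varianceProxy b * θ ^ 2) := by
  set m : ℝ := (1 - p : ℝ) / p
  have hm : 0 ≤ m := div_nonneg (sub_nonneg.2 p.2.2) p.2.1
  have hθ1 : |θ| ≤ 1 := by nlinarith [mul_nonneg (hm.trans hb) (abs_nonneg θ)]
  have hy : m * (exp θ - 1) ≤ 1 / 2 := geometric_mean_mul_exp_sub_one_le_half hb hθ
  calc mgf (fun n : ℕ => (n - m : ℝ)) (geometricMeasure p) θ
      = (1 - m * (exp θ - 1))⁻¹ * exp (θ * -m) := by
        simp only [sub_eq_add_neg]
        rw [mgf_add_const, mgf_geometricMeasure hp (hy.trans_lt one_half_lt_one), ← sub_eq_add_neg,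
          ← sub_eq_add_neg]
    _ ≤ exp (m * (exp θ - 1) + 2 * (m * (exp θ - 1)) ^ 2) * exp (θ * -m) := by
        gcongr
        exact inv_one_sub_le_exp hy
    _ ≤ exp (varianceProxy b * θ ^ 2) := by
        rw [← exp_add]
        gcongr
        linarith [mul_exp_sub_one_add_sq_le hm hb hθ1]

end Geometric

section Chernoff

variable {J : Type*} [Fintype J]

theorem pi_measureReal_ge_sum_le {Ω : J → Type*} [∀ j, MeasurableSpace (Ω j)]
    (μ : ∀ j, Measure (Ω j)) [∀ j, IsProbabilityMeasure (μ j)] {X : ∀ j, Ω j → ℝ} {θ : J → ℝ}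
    {κ : ℝ} (hint : ∀ j, Integrable (fun x => exp (θ j * X j x)) (μ j))
    (hmgf : ∀ j, mgf (X j) (μ j) (θ j) ≤ exp κ) (r : ℝ) :
    (Measure.pi μ).real {ω | r ≤ ∑ j, θ j * X j (ω j)} ≤ exp (κ * Fintype.card J - r) := by
  have hexp (ω : ∀ j, Ω j) :
      exp (1 * ∑ j, θ j * X j (ω j)) = ∏ j, exp (θ j * X j (ω j)) := by rw [one_mul, exp_sum]
  have hint' : Integrable (fun ω : ∀ j, Ω j => exp (1 * ∑ j, θ j * X j (ω j)))
      (Measure.pi μ) := by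
    simpa only [hexp] using Integrable.fintype_prod_dep hint
  have hmgf' : mgf (fun ω : ∀ j, Ω j => ∑ j, θ j * X j (ω j)) (Measure.pi μ) 1 ≤
      exp (κ * Fintype.card J) :=
    calc mgf (fun ω : ∀ j, Ω j => ∑ j, θ j * X j (ω j)) (Measure.pi μ) 1
        = ∏ j, mgf (X j) (μ j) (θ j) := by
          simp only [mgf, hexp]
          exact integral_fintype_prod_eq_prod fun j x => exp (θ j * X j x)
      _ ≤ ∏ _j : J, exp κ := Finset.prod_le_prod (fun j _ => mgf_nonneg) fun j _ => hmgf j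
      _ = exp (κ * Fintype.card J) := by
          rw [Finset.prod_const, ← exp_nat_mul, Finset.card_univ, mul_comm]
  calc (Measure.pi μ).real {ω | r ≤ ∑ j, θ j * X j (ω j)}
      ≤ exp (-1 * r) * mgf (fun ω : ∀ j, Ω j => ∑ j, θ j * X j (ω j)) (Measure.pi μ) 1 :=
        measure_ge_le_exp_mul_mgf r zero_le_one hint'
    _ ≤ exp (-1 * r) * exp (κ * Fintype.card J) := by gcongr
    _ = exp (κ * Fintype.card J - r) := by rw [← exp_add]; congr 1; ring

end Chernoff

section Occupation

/-- The Bose–Einstein occupation, i.e. the mean number of particles in a state whose reduced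
energy `β λ - ν` is `h`. -/
noncomputable def occupation (h : ℝ) : ℝ := (exp h - 1)⁻¹

/-- The probability `1 - exp (-h)` that a state of reduced energy `h` is empty, encoded as the
parameter of a geometric law; the projection onto `[0, 1]` truncates only for `h < 0`. -/
noncomputable def vacancy (h : ℝ) : unitInterval :=
  Set.projIcc 0 1 zero_le_one (1 - exp (-h))

/-- The entropy of the geometric law of the number of particles in a state of reduced energy
`h`. -/
noncomputable def stateEntropy (h : ℝ) : ℝ := h * occupation h - log (vacancy h)

variable {a g h : ℝ}

theorem exp_sub_one_pos (hh : 0 < h) : 0 < exp h - 1 := sub_pos.2 (one_lt_exp_iff.2 hh)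

theorem occupation_pos (hh : 0 < h) : 0 < occupation h := inv_pos.2 (exp_sub_one_pos hh)

theorem occupation_anti (hg : 0 < g) (hgh : g ≤ h) : occupation h ≤ occupation g :=
  inv_anti₀ (exp_sub_one_pos hg) (sub_le_sub_right (exp_le_exp.2 hgh) 1)

theorem occupation_le_inv_iff (ha : 0 < a) (hh : 0 < h) :
    occupation h ≤ a⁻¹ ↔ log (1 + a) ≤ h := by
  rw [occupation, inv_le_inv₀ (exp_sub_one_pos hh) ha, le_sub_iff_add_le',
    log_le_iff_le_exp (by positivity)]

theorem inv_le_occupation_iff (ha : 0 < a) (hh : 0 < h) :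
    a⁻¹ ≤ occupation h ↔ h ≤ log (1 + a) := by
  rw [occupation, inv_le_inv₀ ha (exp_sub_one_pos hh), sub_le_iff_le_add',
    le_log_iff_exp_le (by positivity)]

theorem mul_occupation_le_one (hh : 0 < h) : h * occupation h ≤ 1 := by
  rw [occupation, ← div_eq_mul_inv, div_le_one (exp_sub_one_pos hh)]
  linarith [add_one_le_exp h]

theorem coe_vacancy (hh : 0 ≤ h) : (vacancy h : ℝ) = 1 - exp (-h) := by
  have hle : exp (-h) ≤ 1 := exp_le_one_iff.2 (neg_nonpos.2 hh)
  rw [vacancy, Set.projIcc_of_mem zero_le_one (x := 1 - exp (-h))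
    ⟨sub_nonneg.2 hle, sub_le_self _ (exp_pos _).le⟩]

theorem vacancy_pos (hh : 0 < h) : 0 < (vacancy h : ℝ) := by
  rw [coe_vacancy hh.le]
  exact sub_pos.2 (exp_lt_one_iff.2 (neg_neg_of_pos hh))

theorem vacancy_ne_zero (hh : 0 < h) : vacancy h ≠ 0 :=
  unitInterval.pos_iff_ne_zero.1 (vacancy_pos hh)

theorem vacancy_mono (hgh : g ≤ h) : vacancy g ≤ vacancy h :=
  Set.monotone_projIcc _ (by gcongr)

theorem one_sub_vacancy_div_vacancy (hh : 0 < h) :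
    (1 - vacancy h : ℝ) / vacancy h = occupation h := by
  have hpos := exp_sub_one_pos hh
  rw [coe_vacancy hh.le, occupation, exp_neg]
  field_simp
  ring

theorem one_sub_log_vacancy_nonneg (h : ℝ) : 0 ≤ 1 - log (vacancy h) :=
  sub_nonneg.2 <| (log_nonpos (vacancy h).2.1 (vacancy h).2.2).trans zero_le_one

theorem stateEntropy_le (hg : 0 < g) (hgh : g ≤ h) : stateEntropy h ≤ 1 - log (vacancy g) :=
  sub_le_sub (mul_occupation_le_one (hg.trans_le hgh))
    (log_le_log (vacancy_pos hg) (vacancy_mono hgh))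

variable {J : Type*} [Fintype J]

theorem log_one_add_sub_le_and_le_of_sum_occupation_eq {h : J → ℝ} {a₁ a₂ t N : ℝ}
    (ha₁ : 0 < a₁) (hN : 0 < N) (h₁ : a₁ * N ≤ Fintype.card J) (h₂ : Fintype.card J ≤ a₂ * N)
    (hh : ∀ j, 0 < h j) (hspread : ∀ i j, h i - h j ≤ t)
    (hsum : ∑ j, occupation (h j) = N) (i : J) :
    log (1 + a₁) - t ≤ h i ∧ h i ≤ t + log (1 + a₂) := by
  have ha₂ : 0 < a₂ := ha₁.trans_le (le_of_mul_le_mul_right (h₁.trans h₂) hN)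
  have ht : 0 ≤ t := by simpa only [sub_self] using hspread i i
  constructor
  · have hpos : 0 < h i + t := add_pos_of_pos_of_nonneg (hh i) ht
    have hle : Fintype.card J * occupation (h i + t) ≤ N := by
      rw [← hsum, ← nsmul_eq_mul]
      exact Finset.card_nsmul_le_sum _ _ _ fun j _ =>
        occupation_anti (hh j) (by linarith [hspread j i])
    refine sub_le_iff_le_add.2 ((occupation_le_inv_iff ha₁ hpos).1 ?_)
    rw [← one_div, le_div_iff₀' ha₁]
    nlinarith [mul_le_mul_of_nonneg_right h₁ (occupation_pos hpos).le]
  · rcases le_or_gt (h i - t) 0 with hneg | hpos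
    · linarith [log_nonneg (by linarith : 1 ≤ 1 + a₂)]
    have hle : N ≤ Fintype.card J * occupation (h i - t) := by
      rw [← hsum, ← nsmul_eq_mul]
      exact Finset.sum_le_card_nsmul _ _ _ fun j _ =>
        occupation_anti hpos (by linarith [hspread i j])
    refine sub_le_iff_le_add'.1 ((inv_le_occupation_iff ha₂ hpos).1 ?_)
    rw [← one_div, div_le_iff₀' ha₂]
    nlinarith [mul_le_mul_of_nonneg_right h₂ (occupation_pos hpos).le]

end Occupation

section BoseMeasure

variable {J : Type*} [Fintype J]

/-- The grand canonical ensemble: the law of independent geometric occupation numbers whose means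
are the Bose–Einstein values for the reduced energies `h`. -/
noncomputable def boseMeasure (h : J → ℝ) : Measure (J → ℕ) :=
  Measure.pi fun j => geometricMeasure (vacancy (h j))

instance (h : J → ℝ) : IsProbabilityMeasure (boseMeasure h) := by
  unfold boseMeasure
  infer_instance

/-- The deviation from its mean under `boseMeasure h` of the linear statistic with
coefficients `u`. -/
noncomputable def fluctuation (h u : J → ℝ) (n : J → ℕ) : ℝ :=
  ∑ j, u j * (n j - occupation (h j))

theorem fluctuation_neg (h u : J → ℝ) (n : J → ℕ) :
    fluctuation h (-u) n = -fluctuation h u n := by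
  simp only [fluctuation, Pi.neg_apply, neg_mul, Finset.sum_neg_distrib]

theorem fluctuation_const_mul (h : J → ℝ) (c : ℝ) (u : J → ℝ) (n : J → ℕ) :
    fluctuation h (fun j => c * u j) n = c * fluctuation h u n := by
  simp only [fluctuation, Finset.mul_sum, mul_assoc]

theorem fluctuation_eq_sub (h u : J → ℝ) (n : J → ℕ) :
    fluctuation h u n = ∑ j, u j * n j - ∑ j, u j * occupation (h j) := by
  simp only [fluctuation, mul_sub, Finset.sum_sub_distrib]

variable {h u : J → ℝ}

theorem boseMeasure_real_singleton (hh : ∀ j, 0 < h j) (n : J → ℕ) :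
    (boseMeasure h).real {n} = exp (-(∑ j, stateEntropy (h j)) - fluctuation h h n) := by
  rw [boseMeasure, measureReal_def, Measure.pi_singleton, ENNReal.toReal_prod, fluctuation,
    ← Finset.sum_neg_distrib, ← Finset.sum_sub_distrib, exp_sum]
  refine Finset.prod_congr rfl fun j _ => ?_
  calc (geometricMeasure (vacancy (h j)) {n j}).toReal
      = exp (-h j) ^ n j * vacancy (h j) := by
        rw [← measureReal_def, geometricMeasure_real_singleton (vacancy_ne_zero (hh j)),
          coe_vacancy (hh j).le, sub_sub_cancel]
    _ = exp (n j * -h j) * exp (log (vacancy (h j))) := by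
        rw [exp_nat_mul, exp_log (vacancy_pos (hh j))]
    _ = exp (-stateEntropy (h j) - h j * (n j - occupation (h j))) := by
        rw [← exp_add, stateEntropy]
        congr 1
        ring

variable {b θ : ℝ}

theorem boseMeasure_real_le_fluctuation (hh : ∀ j, 0 < h j) (hb : ∀ j, occupation (h j) ≤ b)
    (hu : ∀ j, |u j| ≤ 1) (hθ₀ : 0 ≤ θ) (hθ : (1 + 4 * b) * θ ≤ 1) (y : ℝ) :
    (boseMeasure h).real {n | y ≤ fluctuation h u n} ≤
      exp (varianceProxy b * θ ^ 2 * Fintype.card J - θ * y) := by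
  have hb₀ (j : J) : 0 ≤ b := (occupation_pos (hh j)).le.trans (hb j)
  have hmean (j : J) : (1 - vacancy (h j) : ℝ) / vacancy (h j) ≤ b :=
    (one_sub_vacancy_div_vacancy (hh j)).trans_le (hb j)
  have hθu (j : J) : |θ * u j| ≤ θ := by
    rw [abs_mul, abs_of_nonneg hθ₀]
    exact mul_le_of_le_one_right hθ₀ (hu j)
  have hsmall (j : J) : (1 + 4 * b) * |θ * u j| ≤ 1 :=
    (mul_le_mul_of_nonneg_left (hθu j) (by linarith [hb₀ j])).trans hθ
  have hsub : {n : J → ℕ | y ≤ fluctuation h u n} ⊆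
      {n | θ * y ≤ ∑ j, θ * u j * ((n j : ℝ) - (1 - vacancy (h j) : ℝ) / vacancy (h j))} := by
    intro n (hn : y ≤ fluctuation h u n)
    simp only [Set.mem_ofPred_eq, one_sub_vacancy_div_vacancy (hh _)]
    exact (mul_le_mul_of_nonneg_left hn hθ₀).trans_eq (fluctuation_const_mul h θ u n).symm
  refine (measureReal_mono hsub).trans (pi_measureReal_ge_sum_le
    (fun j => geometricMeasure (vacancy (h j)))
    (X := fun j (n : ℕ) => (n : ℝ) - (1 - vacancy (h j) : ℝ) / vacancy (h j)) (fun j =>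
      integrable_exp_mul_sub_mean_geometricMeasure (vacancy_ne_zero (hh j)) (hmean j) (hsmall j))
    (fun j => ?_) _)
  refine (mgf_sub_mean_geometricMeasure_le (vacancy_ne_zero (hh j)) (hmean j)
    (hsmall j)).trans (exp_le_exp.2 ?_)
  exact mul_le_mul_of_nonneg_left (sq_le_sq.2 ((hθu j).trans (le_abs_self θ)))
    (varianceProxy_nonneg (hb₀ j))

theorem boseMeasure_real_mul_lt_fluctuation {D : ℝ} (hD : 0 ≤ D) (hh : ∀ j, 0 < h j)
    (hb : ∀ j, occupation (h j) ≤ b) (hu : ∀ j, |u j| ≤ D) (hθ₀ : 0 ≤ θ)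
    (hθ : (1 + 4 * b) * θ ≤ 1) (y : ℝ) :
    (boseMeasure h).real {n | D * y < fluctuation h u n} ≤
      exp (varianceProxy b * θ ^ 2 * Fintype.card J - θ * y) := by
  rcases hD.eq_or_lt with rfl | hD
  · have hu₀ : u = 0 := funext fun j => abs_nonpos_iff.1 (hu j)
    simpa [hu₀, fluctuation] using (exp_pos _).le
  have hu' (j : J) : |D⁻¹ * u j| ≤ 1 := by
    rw [abs_mul, abs_of_pos (inv_pos.2 hD), inv_mul_le_one₀ hD]
    exact hu j
  refine (measureReal_mono fun n (hn : D * y < fluctuation h u n) => ?_).trans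
    (boseMeasure_real_le_fluctuation hh hb hu' hθ₀ hθ y)
  rw [Set.mem_ofPred_eq, fluctuation_const_mul, le_inv_mul_iff₀ hD]
  exact hn.le

theorem boseMeasure_real_le_abs_fluctuation (hh : ∀ j, 0 < h j)
    (hb : ∀ j, occupation (h j) ≤ b) (hu : ∀ j, |u j| ≤ 1) (hθ₀ : 0 ≤ θ)
    (hθ : (1 + 4 * b) * θ ≤ 1) (y : ℝ) :
    (boseMeasure h).real {n | y ≤ |fluctuation h u n|} ≤
      2 * exp (varianceProxy b * θ ^ 2 * Fintype.card J - θ * y) := by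
  have hunion : {n : J → ℕ | y ≤ |fluctuation h u n|} =
      {n | y ≤ fluctuation h u n} ∪ {n | y ≤ fluctuation h (-u) n} := by
    ext n
    simp only [Set.mem_union, Set.mem_ofPred_eq, fluctuation_neg, le_abs]
  rw [hunion, two_mul]
  refine (measureReal_union_le _ _).trans (add_le_add
    (boseMeasure_real_le_fluctuation hh hb hu hθ₀ hθ y)
    (boseMeasure_real_le_fluctuation hh hb (fun j => ?_) hθ₀ hθ y))
  rw [Pi.neg_apply, abs_neg]
  exact hu j

theorem one_fourth_le_boseMeasure_real_fluctuation_le {w : J → ℝ} {D G y : ℝ}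
    (hh : ∀ j, 0 < h j) (hb : ∀ j, occupation (h j) ≤ b) (hD : 0 ≤ D) (hw : ∀ j, |w j| ≤ D)
    (hG : 0 ≤ G) (hhG : ∀ j, h j ≤ G) (hθ₀ : 0 ≤ θ) (hθ : (1 + 4 * b) * θ ≤ 1)
    (htail : varianceProxy b * θ ^ 2 * Fintype.card J + log 4 ≤ θ * y) :
    1 / 4 ≤ (boseMeasure h).real {n | fluctuation h 1 n ≤ y ∧ fluctuation h w n ≤ D * y ∧
      -(G * y) ≤ fluctuation h h n} := by
  have hquarter : exp (varianceProxy b * θ ^ 2 * Fintype.card J - θ * y) ≤ 1 / 4 := by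
    rw [one_div, ← exp_log (by norm_num : (0 : ℝ) < 4), ← exp_neg, exp_le_exp]
    linarith
  have hexceed {D : ℝ} {u : J → ℝ} (hD : 0 ≤ D) (hu : ∀ j, |u j| ≤ D) :
      (boseMeasure h).real {n | D * y < fluctuation h u n} ≤ 1 / 4 :=
    (boseMeasure_real_mul_lt_fluctuation hD hh hb hu hθ₀ hθ y).trans hquarter
  set T := {n : J → ℕ | fluctuation h 1 n ≤ y ∧ fluctuation h w n ≤ D * y ∧
    -(G * y) ≤ fluctuation h h n}
  have hcover : Set.univ ⊆ T ∪ {n | 1 * y < fluctuation h 1 n} ∪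
      {n | D * y < fluctuation h w n} ∪ {n | G * y < fluctuation h (-h) n} := by
    intro n _
    simp only [T, Set.mem_union, Set.mem_ofPred_eq, fluctuation_neg, one_mul]
    by_contra! hn
    obtain ⟨⟨⟨hT, hone⟩, hwn⟩, hhn⟩ := hn
    linarith [hT hone hwn]
  have hone := hexceed (u := 1) zero_le_one fun _ => abs_one.le
  have hwD := hexceed hD hw
  have hhG' := hexceed (u := -h) hG fun j => by
    rw [Pi.neg_apply, abs_neg, abs_of_pos (hh j)]
    exact hhG j
  have htotal :=
    calc 1 = (boseMeasure h).real Set.univ := probReal_univ.symm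
      _ ≤ (boseMeasure h).real (T ∪ {n | 1 * y < fluctuation h 1 n} ∪
          {n | D * y < fluctuation h w n} ∪ {n | G * y < fluctuation h (-h) n}) :=
        measureReal_mono hcover
      _ ≤ (boseMeasure h).real T + (boseMeasure h).real {n | 1 * y < fluctuation h 1 n} +
          (boseMeasure h).real {n | D * y < fluctuation h w n} +
          (boseMeasure h).real {n | G * y < fluctuation h (-h) n} := by
        refine (measureReal_union_le _ _).trans (add_le_add_left ?_ _)
        exact (measureReal_union_le _ _).trans (add_le_add_left (measureReal_union_le _ _) _)
  linarith

end BoseMeasure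

section Counting

variable {α : Type*} [MeasurableSpace α] [MeasurableSingletonClass α] (μ : Measure α)
  [IsFiniteMeasure μ] {T : Set α} {c : ℝ}

theorem measureReal_eq_sum_singleton (hT : T.Finite) :
    μ.real T = ∑ x ∈ hT.toFinset, μ.real {x} := by
  rw [sum_measureReal_singleton, hT.coe_toFinset]

theorem ncard_mul_le_measureReal (hT : T.Finite) (hc : ∀ x ∈ T, c ≤ μ.real {x}) :
    T.ncard * c ≤ μ.real T := by
  rw [measureReal_eq_sum_singleton μ hT, Set.ncard_eq_toFinset_card T hT, ← nsmul_eq_mul]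
  exact Finset.card_nsmul_le_sum _ _ _ fun x hx => hc x (hT.mem_toFinset.1 hx)

theorem measureReal_le_ncard_mul (hT : T.Finite) (hc : ∀ x ∈ T, μ.real {x} ≤ c) :
    μ.real T ≤ T.ncard * c := by
  rw [measureReal_eq_sum_singleton μ hT, Set.ncard_eq_toFinset_card T hT, ← nsmul_eq_mul]
  exact Finset.sum_le_card_nsmul _ _ _ fun x hx => hc x (hT.mem_toFinset.1 hx)

end Counting

section Patterns

variable {J : Type*} [Fintype J]

/-- The microcanonical ensemble: the occupation patterns of the states `J`, with energies `lam`,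
by `N` particles of total energy at most `E`. -/
def patterns (lam : J → ℝ) (N : ℕ) (E : ℝ) : Set (J → ℕ) :=
  {n | ∑ j, n j = N ∧ ∑ j, lam j * (n j : ℝ) ≤ E}

theorem patterns_finite (lam : J → ℝ) (N : ℕ) (E : ℝ) : (patterns lam N E).Finite := by
  classical
  refine (Set.finite_Iic (fun _ => N : J → ℕ)).subset ?_
  rintro n ⟨hN, -⟩ j
  exact hN ▸ Finset.single_le_sum (f := n) (fun _ _ => Nat.zero_le _) (Finset.mem_univ j)

end Patterns

section Absorb

variable {J : Type*} [DecidableEq J] {F : Finset J} {j₀ : J} {N : ℕ} {n : F → ℕ}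

/-- The pattern that agrees with `n` on the states of `F` and puts all remaining ones of the `N`
particles into the state `j₀ ∉ F`. If `n` has more than `N` particles, the truncated subtraction
leaves `j₀` empty. -/
noncomputable def absorb (F : Finset J) (j₀ : J) (N : ℕ) (n : F → ℕ) : J → ℕ :=
  Function.extend Subtype.val n (Pi.single j₀ (N - ∑ j, n j))

theorem absorb_of_mem (j : F) : absorb F j₀ N n j = n j :=
  Subtype.val_injective.extend_apply _ _ j

theorem absorb_of_notMem {j : J} (hj : j ∉ F) :
    absorb F j₀ N n j = Pi.single (M := fun _ => ℕ) j₀ (N - ∑ j, n j) j :=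
  Function.extend_apply' _ _ _ fun ⟨i, hi⟩ => hj (hi ▸ i.2)

theorem absorb_injective : Function.Injective (absorb F j₀ N) :=
  Function.LeftInverse.injective (g := fun (m : J → ℕ) (j : F) => m j) fun _ =>
    funext fun j => absorb_of_mem j

variable [Fintype J]

theorem sum_mul_absorb (hj₀ : j₀ ∉ F) (hn : ∑ j, n j ≤ N) (c : J → ℝ) :
    ∑ j, c j * (absorb F j₀ N n j : ℝ) = c j₀ * N + ∑ j : F, (c j - c j₀) * n j := by
  have hmem : ∑ j ∈ F, c j * (absorb F j₀ N n j : ℝ) = ∑ j : F, c j * n j := by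
    rw [← Finset.sum_coe_sort]
    simp only [absorb_of_mem]
  have hnotMem : ∑ j ∈ Fᶜ, c j * (absorb F j₀ N n j : ℝ) = c j₀ * (N - ∑ j, (n j : ℝ)) := by
    rw [Finset.sum_eq_single_of_mem j₀ (Finset.mem_compl.2 hj₀) fun j hj hne => ?_,
      absorb_of_notMem hj₀, Pi.single_eq_same, Nat.cast_sub hn, Nat.cast_sum]
    rw [absorb_of_notMem (Finset.mem_compl.1 hj), Pi.single_eq_of_ne hne, Nat.cast_zero, mul_zero]
  rw [← Finset.sum_add_sum_compl F, hmem, hnotMem]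
  simp only [sub_mul, mul_sub, Finset.sum_sub_distrib, ← Finset.mul_sum]
  ring

theorem absorb_mem_patterns {lam : J → ℝ} {E : ℝ} (hj₀ : j₀ ∉ F) (hn : ∑ j, n j ≤ N)
    (hE : lam j₀ * N + ∑ j : F, (lam j - lam j₀) * n j ≤ E) :
    absorb F j₀ N n ∈ patterns lam N E := by
  refine ⟨?_, (sum_mul_absorb hj₀ hn lam).trans_le hE⟩
  have hcount := sum_mul_absorb hj₀ hn fun _ => 1
  simp only [one_mul, sub_self, zero_mul, Finset.sum_const_zero, add_zero] at hcount
  exact_mod_cast hcount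

end Absorb

section ExtremalStates

variable {J : Type*} [Fintype J]

theorem exists_top_finset (f : J → ℝ) {k : ℕ} (hk : k ≤ Fintype.card J) :
    ∃ S : Finset J, S.card = k ∧ ∀ i ∈ S, ∀ j ∉ S, f j ≤ f i := by
  classical
  induction k with
  | zero => exact ⟨∅, rfl, fun _ hi => absurd hi (Finset.notMem_empty _)⟩
  | succ k ih =>
    obtain ⟨S, hS, hf⟩ := ih (by omega)
    have hne : Sᶜ.Nonempty := by
      rw [← Finset.card_pos, Finset.card_compl]
      omega
    obtain ⟨i, hi, hmax⟩ := Sᶜ.exists_max_image f hne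
    rw [Finset.mem_compl] at hi
    refine ⟨insert i S, by rw [Finset.card_insert_of_notMem hi, hS], fun i' hi' j hj => ?_⟩
    rw [Finset.mem_insert, not_or] at hj
    rcases Finset.mem_insert.1 hi' with rfl | hi'
    · exact hmax j (Finset.mem_compl.2 hj.2)
    · exact hf i' hi' j hj.2

theorem exists_top_finset_threshold (f : J → ℝ) {k : ℕ} (hk : k < Fintype.card J) :
    ∃ (S : Finset J) (i : J), S.card = k ∧ (∀ j ∈ S, f i ≤ f j) ∧ ∀ j ∉ S, f j ≤ f i := by
  classical
  obtain ⟨S, hS, hf⟩ := exists_top_finset f hk.le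
  have hne : Sᶜ.Nonempty := by
    rw [← Finset.card_pos, Finset.card_compl]
    omega
  obtain ⟨i, hi, hmax⟩ := Sᶜ.exists_max_image f hne
  exact ⟨S, i, hS, fun j hj => hf j hj i (Finset.mem_compl.1 hi),
    fun j hj => hmax j (Finset.mem_compl.2 hj)⟩

theorem exists_extremal_states [DecidableEq J] (lam occ : J → ℝ) {k : ℕ} {ρ y : ℝ}
    (hk : k < Fintype.card J) (hρ₀ : 0 ≤ ρ) (hρ : ∀ j, ρ ≤ occ j) (hy : y ≤ k * ρ) :
    ∃ (F : Finset J) (j₀ : J) (D : ℝ), Fᶜ.card ≤ k + 1 ∧ j₀ ∉ F ∧ (∀ j, lam j₀ ≤ lam j) ∧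
      0 ≤ D ∧ (∀ j ∈ F, lam j - lam j₀ ≤ D) ∧ y ≤ ∑ j ∈ Fᶜ, occ j ∧
      D * y ≤ ∑ j ∈ Fᶜ, (lam j - lam j₀) * occ j := by
  obtain ⟨T, i, hT, htop, hrest⟩ := exists_top_finset_threshold lam hk
  obtain ⟨j₀, -, hmin⟩ := Finset.univ.exists_min_image lam ⟨i, Finset.mem_univ i⟩
  replace hmin (j : J) : lam j₀ ≤ lam j := hmin j (Finset.mem_univ j)
  have hD : 0 ≤ lam i - lam j₀ := sub_nonneg.2 (hmin i)
  have hocc (j : J) : 0 ≤ occ j := hρ₀.trans (hρ j)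
  have hsum : y ≤ ∑ j ∈ T, occ j :=
    calc y ≤ T.card • ρ := by rwa [hT, nsmul_eq_mul]
      _ ≤ ∑ j ∈ T, occ j := Finset.card_nsmul_le_sum _ _ _ fun j _ => hρ j
  have hsub : T ⊆ insert j₀ T := Finset.subset_insert _ _
  refine ⟨(insert j₀ T)ᶜ, j₀, lam i - lam j₀, ?_, ?_, hmin, hD, fun j hj => ?_, ?_, ?_⟩
  · rw [compl_compl]
    exact hT ▸ Finset.card_insert_le _ _
  · rw [Finset.mem_compl, not_not]
    exact Finset.mem_insert_self _ _
  · exact sub_le_sub_right (hrest j fun hjT => Finset.mem_compl.1 hj (hsub hjT)) _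
  · rw [compl_compl]
    exact hsum.trans (Finset.sum_le_sum_of_subset_of_nonneg hsub fun j _ _ => hocc j)
  · rw [compl_compl]
    calc (lam i - lam j₀) * y ≤ (lam i - lam j₀) * ∑ j ∈ T, occ j := by gcongr
      _ = ∑ j ∈ T, (lam i - lam j₀) * occ j := Finset.mul_sum _ _ _
      _ ≤ ∑ j ∈ T, (lam j - lam j₀) * occ j := Finset.sum_le_sum fun j hj =>
          mul_le_mul_of_nonneg_right (sub_le_sub_right (htop j hj) _) (hocc j)
      _ ≤ ∑ j ∈ insert j₀ T, (lam j - lam j₀) * occ j :=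
          Finset.sum_le_sum_of_subset_of_nonneg hsub
            fun j _ _ => mul_nonneg (sub_nonneg.2 (hmin j)) (hocc j)

end ExtremalStates

section LowerBound

variable {J : Type*} [Fintype J] {lam h : J → ℝ} {N : ℕ} {E G y θ : ℝ}

theorem absorb_mem_patterns_of_fluctuation_le [DecidableEq J] {F : Finset J} {j₀ : J} {D : ℝ}
    {n : F → ℕ} (hN : ∑ j, occupation (h j) = N) (hE : ∑ j, lam j * occupation (h j) ≤ E)
    (hj₀ : j₀ ∉ F) (hy : y ≤ ∑ j ∈ Fᶜ, occupation (h j))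
    (hDy : D * y ≤ ∑ j ∈ Fᶜ, (lam j - lam j₀) * occupation (h j))
    (hcount : fluctuation (fun j : F => h j) 1 n ≤ y)
    (henergy : fluctuation (fun j : F => h j) (fun j => lam j - lam j₀) n ≤ D * y) :
    absorb F j₀ N n ∈ patterns lam N E := by
  have hsplit (c : J → ℝ) : ∑ j : F, c j * occupation (h j) + ∑ j ∈ Fᶜ, c j * occupation (h j) =
      ∑ j, c j * occupation (h j) := by
    rw [Finset.sum_coe_sort F fun j => c j * occupation (h j), Finset.sum_add_sum_compl]
  refine absorb_mem_patterns hj₀ ?_ ?_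
  · have hsplit_one := hsplit fun _ => 1
    simp only [fluctuation_eq_sub, Pi.one_apply, one_mul] at hcount hsplit_one
    rw [← Nat.cast_le (α := ℝ), Nat.cast_sum]
    linarith
  · have hsplit_lam := hsplit fun j => lam j - lam j₀
    have hshift : ∑ j, (lam j - lam j₀) * occupation (h j) =
        ∑ j, lam j * occupation (h j) - lam j₀ * N := by
      simp only [sub_mul, Finset.sum_sub_distrib, ← Finset.mul_sum, hN]
    rw [fluctuation_eq_sub] at henergy
    linarith

theorem sum_stateEntropy_le_sum_add [DecidableEq J] {g : ℝ} (hg : 0 < g) (hgh : ∀ j, g ≤ h j)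
    {F : Finset J} {k : ℕ} (hF : Fᶜ.card ≤ k) :
    ∑ j, stateEntropy (h j) ≤ ∑ j : F, stateEntropy (h j) + k * (1 - log (vacancy g)) := by
  rw [← Finset.sum_add_sum_compl F, ← Finset.sum_coe_sort F]
  gcongr
  calc ∑ j ∈ Fᶜ, stateEntropy (h j) ≤ Fᶜ.card • (1 - log (vacancy g)) :=
        Finset.sum_le_card_nsmul _ _ _ fun j _ => stateEntropy_le hg (hgh j)
    _ ≤ k * (1 - log (vacancy g)) := by
        rw [nsmul_eq_mul]
        have := one_sub_log_vacancy_nonneg g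
        gcongr

theorem one_fourth_le_ncard_patterns_mul [DecidableEq J] {F : Finset J} {j₀ : J} {b D : ℝ}
    (hh : ∀ j, 0 < h j) (hb : ∀ j, occupation (h j) ≤ b) (hG : 0 ≤ G) (hhG : ∀ j, h j ≤ G)
    (hN : ∑ j, occupation (h j) = N) (hE : ∑ j, lam j * occupation (h j) ≤ E)
    (hj₀ : j₀ ∉ F) (hmin : ∀ j, lam j₀ ≤ lam j) (hD : 0 ≤ D)
    (hlamD : ∀ j ∈ F, lam j - lam j₀ ≤ D) (hy : y ≤ ∑ j ∈ Fᶜ, occupation (h j))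
    (hDy : D * y ≤ ∑ j ∈ Fᶜ, (lam j - lam j₀) * occupation (h j))
    (hθ₀ : 0 ≤ θ) (hθ : (1 + 4 * b) * θ ≤ 1)
    (htail : varianceProxy b * θ ^ 2 * Fintype.card F + log 4 ≤ θ * y) :
    1 / 4 ≤ (patterns lam N E).ncard * exp (G * y - ∑ j : F, stateEntropy (h j)) := by
  have hw (j : F) : |lam j - lam j₀| ≤ D := by
    rw [abs_of_nonneg (sub_nonneg.2 (hmin j))]
    exact hlamD j j.2
  have hprob := one_fourth_le_boseMeasure_real_fluctuation_le (fun j : F => hh j)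
    (fun j : F => hb j) hD hw hG (fun j : F => hhG j) hθ₀ hθ htail
  set T := {n : F → ℕ | fluctuation (fun j : F => h j) 1 n ≤ y ∧
    fluctuation (fun j : F => h j) (fun j : F => lam j - lam j₀) n ≤ D * y ∧
    -(G * y) ≤ fluctuation (fun j : F => h j) (fun j : F => h j) n}
  have hmaps : Set.MapsTo (absorb F j₀ N) T (patterns lam N E) := fun n hn =>
    absorb_mem_patterns_of_fluctuation_le hN hE hj₀ hy hDy hn.1 hn.2.1
  have hfin := patterns_finite lam N E
  refine hprob.trans ((measureReal_le_ncard_mul _ (hfin.of_injOn hmaps absorb_injective.injOn)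
    fun n hn => ?_).trans (mul_le_mul_of_nonneg_right (Nat.cast_le.2 <|
      Set.ncard_le_ncard_of_injOn _ hmaps absorb_injective.injOn hfin) (exp_pos _).le))
  rw [boseMeasure_real_singleton fun j : F => hh j, exp_le_exp]
  linarith [hn.2.2]

theorem exp_sum_stateEntropy_le_ncard_patterns_mul {g : ℝ} {k : ℕ} (hg : 0 < g)
    (hgh : ∀ j, h j ∈ Set.Icc g G) (hN : ∑ j, occupation (h j) = N)
    (hE : ∑ j, lam j * occupation (h j) ≤ E) (hk : k < Fintype.card J)
    (hy : y ≤ k * occupation G) (hθ₀ : 0 ≤ θ) (hθ : (1 + 4 * occupation g) * θ ≤ 1)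
    (htail : varianceProxy (occupation g) * θ ^ 2 * Fintype.card J + log 4 ≤ θ * y) :
    exp (∑ j, stateEntropy (h j)) ≤ (patterns lam N E).ncard *
      (4 * exp (G * y + (k + 1) * (1 - log (vacancy g)))) := by
  classical
  have hh (j : J) : 0 < h j := hg.trans_le (hgh j).1
  obtain ⟨j⟩ : Nonempty J := Fintype.card_pos_iff.1 (k.zero_le.trans_lt hk)
  have hG : 0 < G := (hh j).trans_le (hgh j).2
  obtain ⟨F, j₀, D, hF, hj₀, hmin, hD, hlamD, hyF, hDy⟩ := exists_extremal_states lam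
    (fun j => occupation (h j)) hk (occupation_pos hG).le
    (fun j => occupation_anti (hh j) (hgh j).2) hy
  have htailF : varianceProxy (occupation g) * θ ^ 2 * Fintype.card F + log 4 ≤ θ * y := by
    refine le_trans ?_ htail
    have := varianceProxy_nonneg (occupation_pos hg).le
    gcongr
    exact Fintype.card_subtype_le _
  have hquarter := one_fourth_le_ncard_patterns_mul hh (fun j => occupation_anti hg (hgh j).1)
    hG.le (fun j => (hgh j).2) hN hE hj₀ hmin hD hlamD hyF hDy hθ₀ hθ htailF
  have hentropy := sum_stateEntropy_le_sum_add hg (fun j => (hgh j).1) hF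
  push_cast at hentropy
  calc exp (∑ j, stateEntropy (h j))
      ≤ exp (∑ j : F, stateEntropy (h j) + (k + 1) * (1 - log (vacancy g))) * 1 := by
        rw [mul_one]
        exact exp_le_exp.2 hentropy
    _ ≤ exp (∑ j : F, stateEntropy (h j) + (k + 1) * (1 - log (vacancy g))) *
        (4 * ((patterns lam N E).ncard * exp (G * y - ∑ j : F, stateEntropy (h j)))) := by
        gcongr
        linarith
    _ = (patterns lam N E).ncard * (4 * exp (G * y + (k + 1) * (1 - log (vacancy g)))) := by
        rw [mul_left_comm, mul_left_comm (exp _), ← exp_add, mul_left_comm 4]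
        congr 3
        ring

end LowerBound

section Equilibrium

variable {J : Type*} [Fintype J]

/-- The exponent `β λ - ν` of the Bose–Einstein formula for each of the states `J`. -/
abbrev reducedEnergy (lam : J → ℝ) (β ν : ℝ) (j : J) : ℝ := β * lam j - ν

/-- The parameters `β`, `ν` of a grand canonical ensemble for which the mean number of particles is
`N` and the mean energy at most `E`. The last condition is complementary slackness: the bound on
the energy is attained unless `β = 0`. -/
structure IsEquilibrium (lam : J → ℝ) (N : ℕ) (E β ν : ℝ) : Prop where
  beta_nonneg : 0 ≤ β
  reducedEnergy_pos : ∀ j, 0 < reducedEnergy lam β ν j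
  sum_occupation : ∑ j, occupation (reducedEnergy lam β ν j) = N
  sum_energy_le : ∑ j, lam j * occupation (reducedEnergy lam β ν j) ≤ E
  beta_mul_sum_energy : β * ∑ j, lam j * occupation (reducedEnergy lam β ν j) = β * E

namespace IsEquilibrium

variable {lam : J → ℝ} {N : ℕ} {E β ν : ℝ}

theorem fluctuation_reducedEnergy_nonpos (heq : IsEquilibrium lam N E β ν) {n : J → ℕ}
    (hn : n ∈ patterns lam N E) :
    fluctuation (reducedEnergy lam β ν) (reducedEnergy lam β ν) n ≤ 0 := by
  have hsum (x : J → ℝ) : ∑ j, reducedEnergy lam β ν j * x j =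
      β * ∑ j, lam j * x j - ν * ∑ j, x j := by
    simp only [sub_mul, Finset.sum_sub_distrib, Finset.mul_sum, mul_assoc]
  have hcount : ∑ j, (n j : ℝ) = N := by exact_mod_cast hn.1
  rw [fluctuation_eq_sub, hsum fun j => (n j : ℝ), hsum, hcount, heq.sum_occupation,
    heq.beta_mul_sum_energy]
  linarith [mul_le_mul_of_nonneg_left hn.2 heq.beta_nonneg]

theorem exp_neg_sum_stateEntropy_le (heq : IsEquilibrium lam N E β ν) {n : J → ℕ}
    (hn : n ∈ patterns lam N E) : exp (-∑ j, stateEntropy (reducedEnergy lam β ν j)) ≤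
      (boseMeasure (reducedEnergy lam β ν)).real {n} := by
  rw [boseMeasure_real_singleton heq.reducedEnergy_pos, exp_le_exp]
  linarith [heq.fluctuation_reducedEnergy_nonpos hn]

theorem ncard_le_abs_fluctuation_le (heq : IsEquilibrium lam N E β ν) {b η : ℝ}
    (hb : ∀ j, occupation (reducedEnergy lam β ν j) ≤ b) (hη₀ : 0 ≤ η)
    (hη : (1 + 4 * b) * η ≤ 1) {u : J → ℝ} (hu : ∀ j, |u j| ≤ 1) (Δ : ℝ) :
    ({n ∈ patterns lam N E | Δ ≤ |fluctuation (reducedEnergy lam β ν) u n|}.ncard : ℝ) ≤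
      exp (∑ j, stateEntropy (reducedEnergy lam β ν j)) *
        (2 * exp (varianceProxy b * η ^ 2 * Fintype.card J - η * Δ)) := by
  rw [← inv_mul_le_iff₀ (exp_pos _), ← exp_neg, mul_comm]
  exact (ncard_mul_le_measureReal _ ((patterns_finite lam N E).subset (Set.sep_subset _ _))
    fun n hn => heq.exp_neg_sum_stateEntropy_le hn.1).trans <|
      (measureReal_mono fun n hn => hn.2).trans
        (boseMeasure_real_le_abs_fluctuation heq.reducedEnergy_pos hb hu hη₀ hη Δ)

theorem patterns_nonempty [Nonempty J] (heq : IsEquilibrium lam N E β ν) :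
    (patterns lam N E).Nonempty := by
  classical
  obtain ⟨j₀, hmin⟩ := Finite.exists_min lam
  refine ⟨Pi.single j₀ N, by simp, le_trans ?_ heq.sum_energy_le⟩
  calc ∑ j, lam j * ((Pi.single j₀ N : J → ℕ) j : ℝ)
      = ∑ j, lam j₀ * occupation (reducedEnergy lam β ν j) := by
        rw [← Finset.mul_sum, heq.sum_occupation, Fintype.sum_eq_single j₀ fun j hne => ?_,
          Pi.single_eq_same]
        rw [Pi.single_eq_of_ne hne, Nat.cast_zero, mul_zero]
    _ ≤ ∑ j, lam j * occupation (reducedEnergy lam β ν j) := Finset.sum_le_sum fun j _ =>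
        mul_le_mul_of_nonneg_right (hmin j) (occupation_pos (heq.reducedEnergy_pos j)).le

theorem reducedEnergy_bounds (heq : IsEquilibrium lam N E β ν) {a₁ a₂ B β₀ : ℝ} (ha₁ : 0 < a₁)
    (hN : 0 < N) (h₁ : a₁ * N ≤ Fintype.card J) (h₂ : Fintype.card J ≤ a₂ * N)
    (hspread : ∀ i j, lam i - lam j ≤ B) (hβ₀ : β ≤ β₀) (j : J) :
    log (1 + a₁) - β₀ * B ≤ reducedEnergy lam β ν j ∧
      reducedEnergy lam β ν j ≤ β₀ * B + log (1 + a₂) := by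
  have hB : 0 ≤ B := by simpa only [sub_self] using hspread j j
  refine log_one_add_sub_le_and_le_of_sum_occupation_eq ha₁ (Nat.cast_pos.2 hN) h₁ h₂
    heq.reducedEnergy_pos (fun i j => ?_) heq.sum_occupation j
  calc reducedEnergy lam β ν i - reducedEnergy lam β ν j = β * (lam i - lam j) := by ring
    _ ≤ β * B := mul_le_mul_of_nonneg_left (hspread i j) heq.beta_nonneg
    _ ≤ β₀ * B := mul_le_mul_of_nonneg_right hβ₀ hB

end IsEquilibrium

end Equilibrium

section LargeN

theorem varianceProxy_mul_inv_sq_mul_add_log_four_le {a b x M : ℝ} (hb : 0 ≤ b) (hx : 0 < x)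
    (hM : M ≤ a * x ^ 2) :
    varianceProxy b * x⁻¹ ^ 2 * M + log 4 ≤ x⁻¹ * ((varianceProxy b * a + log 4) * x) :=
  calc varianceProxy b * x⁻¹ ^ 2 * M + log 4
      ≤ varianceProxy b * x⁻¹ ^ 2 * (a * x ^ 2) + log 4 := by
        have := varianceProxy_nonneg hb
        gcongr
    _ = x⁻¹ * ((varianceProxy b * a + log 4) * x) := by field_simp

theorem exists_eventually_exp_sum_stateEntropy_le {a₁ g : ℝ} (a₂ G : ℝ) (ha₁ : 0 < a₁)
    (hg : 0 < g) :
    ∃ A, ∀ᶠ N : ℕ in atTop, ∀ (J : Type*) [Fintype J] (lam h : J → ℝ) (E : ℝ),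
      a₁ * N ≤ Fintype.card J → Fintype.card J ≤ a₂ * N → (∀ j, h j ∈ Set.Icc g G) →
      ∑ j, occupation (h j) = N → ∑ j, lam j * occupation (h j) ≤ E →
      exp (∑ j, stateEntropy (h j)) ≤ (patterns lam N E).ncard * (4 * exp (A * √N)) := by
  set b := occupation g
  set C := varianceProxy b * a₂ + log 4
  set R := C / occupation G + 2 with hR
  have hsqrt : Tendsto (fun N : ℕ => √(N : ℝ)) atTop atTop :=
    tendsto_sqrt_atTop.comp tendsto_natCast_atTop_atTop
  refine ⟨G * C + R * (1 - log (vacancy g)), ?_⟩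
  filter_upwards [hsqrt.eventually_ge_atTop 1, hsqrt.eventually_ge_atTop (1 + 4 * b),
    hsqrt.eventually_ge_atTop (R / a₁)] with N hx₁ hxb hxR J _ lam h E h₁ h₂ hgh hsum hE
  set x := √(N : ℝ)
  have hx₀ : 0 < x := one_pos.trans_le hx₁
  have hxN : (N : ℝ) = x ^ 2 := (sq_sqrt N.cast_nonneg).symm
  have hN : 0 < (N : ℝ) := hxN ▸ pow_pos hx₀ 2
  obtain ⟨j⟩ : Nonempty J := Fintype.card_pos_iff.1 <|
    Nat.cast_pos.1 ((mul_pos ha₁ hN).trans_le h₁)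
  have hρ : 0 < occupation G := occupation_pos (hg.trans_le ((hgh j).1.trans (hgh j).2))
  have ha₂ : 0 ≤ a₂ := (ha₁.trans_le (le_of_mul_le_mul_right (h₁.trans h₂) hN)).le
  have hC₀ : 0 ≤ C :=
    add_nonneg (mul_nonneg (varianceProxy_nonneg (occupation_pos hg).le) ha₂)
      (log_nonneg (by norm_num))
  set k := ⌈C * x / occupation G⌉₊
  have hk : (k + 1 : ℝ) ≤ R * x := by
    have := Nat.ceil_lt_add_one (div_nonneg (mul_nonneg hC₀ hx₀.le) hρ.le)
    rw [hR, add_mul, div_mul_eq_mul_div]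
    linarith
  have hkJ : (k + 1 : ℝ) ≤ Fintype.card J :=
    calc (k + 1 : ℝ) ≤ R * x := hk
      _ ≤ a₁ * x * x := by gcongr; exact (div_le_iff₀' ha₁).1 hxR
      _ ≤ Fintype.card J := by rwa [mul_assoc, ← sq, ← hxN]
  have htail := varianceProxy_mul_inv_sq_mul_add_log_four_le (occupation_pos hg).le hx₀
    (hxN ▸ h₂ : (Fintype.card J : ℝ) ≤ a₂ * x ^ 2)
  refine (exp_sum_stateEntropy_le_ncard_patterns_mul hg hgh hsum hE (by exact_mod_cast hkJ)
    ((div_le_iff₀ hρ).1 (Nat.le_ceil _)) (inv_nonneg.2 hx₀.le)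
    ((mul_inv_le_iff₀ hx₀).2 (by rwa [one_mul])) htail).trans ?_
  gcongr
  linarith [mul_le_mul_of_nonneg_right hk (one_sub_log_vacancy_nonneg g)]

theorem exists_eventually_ncard_le_abs_fluctuation_le {a₁ g : ℝ} (a₂ G : ℝ) (ha₁ : 0 < a₁)
    (hg : 0 < g) :
    ∃ A, ∀ᶠ N : ℕ in atTop, ∀ (J : Type*) [Fintype J] (lam : J → ℝ) (E β ν : ℝ),
      a₁ * N ≤ Fintype.card J → Fintype.card J ≤ a₂ * N → IsEquilibrium lam N E β ν →
      (∀ j, reducedEnergy lam β ν j ∈ Set.Icc g G) →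
      ∀ u : J → ℝ, (∀ j, |u j| ≤ 1) → ∀ Δ : ℝ,
      ({n ∈ patterns lam N E | Δ ≤ |fluctuation (reducedEnergy lam β ν) u n|}.ncard : ℝ) ≤
        (patterns lam N E).ncard * (8 * exp (A * √N - N ^ (-(1 / 4) : ℝ) * Δ)) := by
  obtain ⟨A, hA⟩ := exists_eventually_exp_sum_stateEntropy_le a₂ G ha₁ hg
  set b := occupation g
  have hη : Tendsto (fun N : ℕ => (1 + 4 * b) * (N : ℝ) ^ (-(1 / 4) : ℝ)) atTop (nhds 0) := by
    simpa only [mul_zero, Function.comp_apply] using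
      ((tendsto_rpow_neg_atTop (by norm_num : (0 : ℝ) < 1 / 4)).comp
        tendsto_natCast_atTop_atTop).const_mul (1 + 4 * b)
  refine ⟨varianceProxy b * a₂ + A, ?_⟩
  filter_upwards [hA, hη.eventually_le_const one_pos, eventually_gt_atTop 0]
    with N hA hη hN J _ lam E β ν h₁ h₂ heq hgh u hu Δ
  have hb (j : J) : occupation (reducedEnergy lam β ν j) ≤ b := occupation_anti hg (hgh j).1
  set η : ℝ := (N : ℝ) ^ (-(1 / 4) : ℝ)
  have hηN : η ^ 2 * N = √N := by
    have hN : 0 < (N : ℝ) := Nat.cast_pos.2 hN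
    rw [← rpow_natCast, ← rpow_mul hN.le, ← rpow_add_one hN.ne', sqrt_eq_rpow]
    norm_num
  have hexponent : varianceProxy b * η ^ 2 * Fintype.card J ≤ varianceProxy b * a₂ * √N :=
    calc varianceProxy b * η ^ 2 * Fintype.card J ≤ varianceProxy b * η ^ 2 * (a₂ * N) := by
          have := varianceProxy_nonneg (occupation_pos hg).le
          gcongr
      _ = varianceProxy b * a₂ * √N := by rw [← hηN]; ring
  calc ({n ∈ patterns lam N E | Δ ≤ |fluctuation (reducedEnergy lam β ν) u n|}.ncard : ℝ)
      ≤ exp (∑ j, stateEntropy (reducedEnergy lam β ν j)) *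
          (2 * exp (varianceProxy b * η ^ 2 * Fintype.card J - η * Δ)) :=
        heq.ncard_le_abs_fluctuation_le hb (rpow_nonneg N.cast_nonneg _) hη hu Δ
    _ ≤ (patterns lam N E).ncard * (4 * exp (A * √N)) *
          (2 * exp (varianceProxy b * a₂ * √N - η * Δ)) := by
        gcongr
        exact hA J lam _ E h₁ h₂ hgh heq.sum_occupation heq.sum_energy_le
    _ = (patterns lam N E).ncard * (8 * exp ((varianceProxy b * a₂ + A) * √N - η * Δ)) := by
        rw [add_mul, add_sub_right_comm, exp_add]
        ring

theorem eventually_exp_lt_div_rpow (A m : ℝ) {c ε : ℝ} (hc : 0 < c) (hε : 0 < ε) :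
    ∀ᶠ x : ℝ in atTop,
      8 * exp (A * √x - x ^ (-(1 / 4) : ℝ) * x ^ (3 / 4 + ε)) < c / x ^ m := by
  have hp : 0 < 1 / 2 + ε := by linarith
  have hdecay : ∀ᶠ x : ℝ in atTop, x ^ m * exp (-(1 / 2) * x ^ (1 / 2 + ε)) < c / 8 := by
    filter_upwards [((tendsto_rpow_mul_exp_neg_mul_atTop_nhds_zero (m / (1 / 2 + ε)) (1 / 2)
      one_half_pos).comp (tendsto_rpow_atTop hp)).eventually_lt_const
        (by positivity : 0 < c / 8), eventually_ge_atTop 0] with x hx hx₀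
    rwa [Function.comp_apply, ← rpow_mul hx₀, mul_div_cancel₀ _ hp.ne'] at hx
  filter_upwards [hdecay, (tendsto_rpow_atTop hε).eventually_ge_atTop (2 * A),
    eventually_gt_atTop 0] with x hx hA hx₀
  have hexponent : A * √x - x ^ (-(1 / 4) : ℝ) * x ^ (3 / 4 + ε) ≤
      -(1 / 2) * x ^ (1 / 2 + ε) := by
    have hpow : x ^ (-(1 / 4) : ℝ) * x ^ (3 / 4 + ε) = √x * x ^ ε := by
      rw [sqrt_eq_rpow, ← rpow_add hx₀, ← rpow_add hx₀]
      congr 1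
      ring
    rw [hpow, rpow_add hx₀, ← sqrt_eq_rpow]
    linarith [mul_le_mul_of_nonneg_right hA (sqrt_nonneg x)]
  rw [lt_div_iff₀ (rpow_pos_of_pos hx₀ m)]
  calc 8 * exp (A * √x - x ^ (-(1 / 4) : ℝ) * x ^ (3 / 4 + ε)) * x ^ m
      ≤ 8 * exp (-(1 / 2) * x ^ (1 / 2 + ε)) * x ^ m := by gcongr
    _ < c := by linarith

theorem eventually_ncard_le_abs_fluctuation_lt {a₁ g c ε : ℝ} (a₂ G m : ℝ) (ha₁ : 0 < a₁)
    (hg : 0 < g) (hc : 0 < c) (hε : 0 < ε) :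
    ∀ᶠ N : ℕ in atTop, ∀ (J : Type*) [Fintype J] (lam : J → ℝ) (E β ν : ℝ),
      a₁ * N ≤ Fintype.card J → Fintype.card J ≤ a₂ * N → IsEquilibrium lam N E β ν →
      (∀ j, reducedEnergy lam β ν j ∈ Set.Icc g G) →
      ∀ u : J → ℝ, (∀ j, |u j| ≤ 1) →
      ({n ∈ patterns lam N E | (N : ℝ) ^ (3 / 4 + ε) ≤
        |fluctuation (reducedEnergy lam β ν) u n|}.ncard : ℝ) <
        c * (patterns lam N E).ncard / (N : ℝ) ^ m := by
  obtain ⟨A, hA⟩ := exists_eventually_ncard_le_abs_fluctuation_le a₂ G ha₁ hg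
  filter_upwards [hA, tendsto_natCast_atTop_atTop.eventually
    (eventually_exp_lt_div_rpow A m hc hε), eventually_gt_atTop 0]
    with N hA hsmall hN J _ lam E β ν h₁ h₂ heq hgh u hu
  have : Nonempty J := Fintype.card_pos_iff.1 <|
    Nat.cast_pos.1 ((mul_pos ha₁ (Nat.cast_pos.2 hN)).trans_le h₁)
  have hpatterns : 0 < (patterns lam N E).ncard :=
    (Set.ncard_pos (patterns_finite lam N E)).2 heq.patterns_nonempty
  refine (hA J lam E β ν h₁ h₂ heq hgh u hu _).trans_lt ?_
  rw [mul_comm c, mul_div_assoc]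
  exact mul_lt_mul_of_pos_left hsmall (Nat.cast_pos.2 hpatterns)

end LargeN

section Levels

variable {s : ℕ} {q : Fin s → ℕ} {lam : Fin s → ℝ} {N : ℕ} {E β ν : ℝ}

theorem sum_states (q : Fin s → ℕ) (f : Fin s → ℝ) :
    ∑ j : (Σ i, Fin (q i)), f j.1 = ∑ i, (q i : ℝ) * f i := by
  simp only [Fintype.sum_sigma, Finset.sum_const, Finset.card_univ, Fintype.card_fin, nsmul_eq_mul]

theorem card_states (q : Fin s → ℕ) :
    (Fintype.card (Σ i, Fin (q i)) : ℝ) = ∑ i, (q i : ℝ) := by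
  simp only [Fintype.card_sigma, Fintype.card_fin, Nat.cast_sum]

theorem sum_states_mul (n : Variant q) (f : Fin s → ℝ) :
    ∑ j : (Σ i, Fin (q i)), f j.1 * (n j : ℝ) = ∑ i, f i * (levelNumber n i : ℝ) := by
  simp only [Fintype.sum_sigma, levelNumber, Nat.cast_sum, Finset.mul_sum]

theorem sum_states_mul_occupation (f : Fin s → ℝ) :
    ∑ j : (Σ i, Fin (q i)), f j.1 * occupation (β * lam j.1 - ν) =
      ∑ i, f i * boseEinstein q lam β ν i := by
  rw [sum_states q fun i => f i * occupation (β * lam i - ν)]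
  refine Finset.sum_congr rfl fun i _ => ?_
  rw [boseEinstein, div_eq_mul_inv, occupation, mul_left_comm]

theorem admissible_eq_patterns (q : Fin s → ℕ) (lam : Fin s → ℝ) (N : ℕ) (E : ℝ) :
    admissible q lam N E = patterns (fun j : Σ i, Fin (q i) => lam j.1) N E := by
  ext n
  have hcount : ∑ j, n j = ∑ i, levelNumber n i := Fintype.sum_sigma _
  rw [admissible, patterns, Set.mem_ofPred_eq, Set.mem_ofPred_eq, hcount, sum_states_mul]

theorem sum_levelNumber_sub_sum_boseEinstein (L : Finset (Fin s)) (n : Variant q) :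
    ∑ i ∈ L, (levelNumber n i : ℝ) - ∑ i ∈ L, boseEinstein q lam β ν i =
      fluctuation (reducedEnergy (fun j : Σ i, Fin (q i) => lam j.1) β ν)
        (fun j => if j.1 ∈ L then 1 else 0) n := by
  rw [fluctuation_eq_sub, sum_states_mul n fun i => if i ∈ L then 1 else 0,
    sum_states_mul_occupation fun i => if i ∈ L then 1 else 0]
  simp only [ite_mul, one_mul, zero_mul, Finset.sum_ite_mem, Finset.univ_inter]

theorem isEquilibrium_states (hβ : 0 ≤ β) (hpos : ∀ i, 0 < β * lam i - ν)
    (hN : ∑ i, boseEinstein q lam β ν i = N)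
    (hE : ∑ i, lam i * boseEinstein q lam β ν i = E ∨
      (β = 0 ∧ ∑ i, lam i * boseEinstein q lam β ν i ≤ E)) :
    IsEquilibrium (fun j : Σ i, Fin (q i) => lam j.1) N E β ν where
  beta_nonneg := hβ
  reducedEnergy_pos j := hpos j.1
  sum_occupation := by
    simpa only [one_mul, hN] using
      sum_states_mul_occupation (q := q) (lam := lam) (β := β) (ν := ν) fun _ => 1
  sum_energy_le := by
    rw [sum_states_mul_occupation]
    exact hE.elim le_of_eq And.right
  beta_mul_sum_energy := by
    rw [sum_states_mul_occupation]
    rcases hE with hE | ⟨hβ, -⟩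
    · rw [hE]
    · rw [hβ, zero_mul, zero_mul]

end Levels

theorem exists_pos_le_and_le_of_pos {δ : ℝ} (hδ : 0 < δ) (t : ℝ) :
    ∃ g, 0 < g ∧ g ≤ δ ∧ (0 < t → g ≤ t) := by
  rcases lt_or_ge 0 t with ht | ht
  · exact ⟨min δ t, lt_min hδ ht, min_le_left _ _, fun _ => min_le_right _ _⟩
  · exact ⟨δ, hδ, le_rfl, fun ht' => absurd ht' ht.not_gt⟩

end OperationalRisk

open OperationalRisk in
theorem lemma1_general (a₁ a₂ B β₀ δ ε : ℝ) (ha₁ : 0 < a₁) (hδ : 0 < δ) (hε : 0 < ε)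
    (c₁ m : ℝ) (hc₁ : 0 < c₁) :
    ∃ N₀ : ℕ, ∀ N : ℕ, N₀ ≤ N →
      ∀ (s : ℕ) (q : Fin s → ℕ) (lam : Fin s → ℝ) (E β' ν' : ℝ) (L : Finset (Fin s)),
        a₁ * N ≤ ∑ i, (q i : ℝ) → ∑ i, (q i : ℝ) ≤ a₂ * N →
        (∀ i j, lam i - lam j ≤ B) →
        0 ≤ β' → β' ≤ β₀ → (∀ i, 0 < β' * lam i - ν') →
        ∑ i, boseEinstein q lam β' ν' i = N →
        (∑ i, lam i * boseEinstein q lam β' ν' i = E ∨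
          (β' = 0 ∧ ∑ i, lam i * boseEinstein q lam β' ν' i ≤ E)) →
        (Real.exp (β₀ * B) < 1 + a₁ ∨ ∀ i, δ ≤ β' * lam i - ν') →
        ({n ∈ admissible q lam N E | (N : ℝ) ^ (3 / 4 + ε) ≤
          |∑ i ∈ L, (levelNumber n i : ℝ) - ∑ i ∈ L, boseEinstein q lam β' ν' i|}.ncard : ℝ) <
          c₁ * ((admissible q lam N E).ncard : ℝ) / (N : ℝ) ^ m := by
  obtain ⟨g, hg, hgδ, hgt⟩ := exists_pos_le_and_le_of_pos hδ (Real.log (1 + a₁) - β₀ * B)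
  obtain ⟨N₀, hN₀⟩ := Filter.eventually_atTop.1 <| (Filter.eventually_gt_atTop 0).and
    (eventually_ncard_le_abs_fluctuation_lt a₂ (β₀ * B + Real.log (1 + a₂)) m ha₁ hg hc₁ hε)
  refine ⟨N₀, fun N hN s q lam E β' ν' L h₁ h₂ hlam hβ hβ₀ hpos hsum hE hgap => ?_⟩
  obtain ⟨hN, hmain⟩ := hN₀ N hN
  rw [← card_states] at h₁ h₂
  have heq := isEquilibrium_states hβ hpos hsum hE
  have hbounds := heq.reducedEnergy_bounds ha₁ hN h₁ h₂ (fun i j => hlam i.1 j.1) hβ₀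
  simp only [admissible_eq_patterns, sum_levelNumber_sub_sum_boseEinstein]
  refine hmain _ _ E β' ν' h₁ h₂ heq (fun j => ⟨?_, (hbounds j).2⟩) _ fun j => ?_
  · rcases hgap with hexp | hgap
    · exact (hgt (sub_pos.2 ((Real.lt_log_iff_exp_lt (by positivity)).2 hexp))).trans (hbounds j).1
    · exact hgδ.trans (hgap j.1)
  · split_ifs <;> simp

open OperationalRisk in
theorem lemma1 (a₁ a₂ B β₀ δ ε : ℝ) (ha₁ : 0 < a₁) (hδ : 0 < δ) (hε : 0 < ε)
    (c₁ m : ℝ) (hc₁ : 0 < c₁) :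
    ∃ N₀ : ℕ, ∀ N : ℕ, N₀ ≤ N →
      ∀ (s : ℕ) (q : Fin s → ℕ) (lam : Fin s → ℝ) (E β' ν' : ℝ) (l : ℕ),
        -- the number `Q` of states is comparable with `N` (if all `q i = 1`, then `Q = s`)
        a₁ * N ≤ ∑ i, (q i : ℝ) → ∑ i, (q i : ℝ) ≤ a₂ * N →
        (∀ i, 0 ≤ lam i ∧ lam i ≤ B) →
        0 ≤ β' → β' ≤ β₀ → (∀ i, 0 < β' * lam i - ν') →
        -- `β'`, `ν'` are determined by `N` and `E`; `β' = 0` if the bound `E` is not active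
        ∑ i, boseEinstein q lam β' ν' i = N →
        (∑ i, lam i * boseEinstein q lam β' ν' i = E ∨
          (β' = 0 ∧ ∑ i, lam i * boseEinstein q lam β' ν' i ≤ E)) →
        -- no condensation: automatic for small `β₀`, otherwise a uniform gap
        (Real.exp (β₀ * B) < 1 + a₁ ∨ ∀ i, δ ≤ β' * lam i - ν') →
        ε * ∑ i, (q i : ℝ) ≤ ∑ i ∈ firstLevels s l, (q i : ℝ) →
        ((deviating q lam N E β' ν' l ((N : ℝ) ^ (3 / 4 + ε))).ncard : ℝ) <
          c₁ * ((admissible q lam N E).ncard : ℝ) / (N : ℝ) ^ m := by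
  obtain ⟨N₀, hN₀⟩ := lemma1_general a₁ a₂ B β₀ δ ε ha₁ hδ hε c₁ m hc₁
  exact ⟨N₀, fun N hN s q lam E β' ν' l h₁ h₂ hlam hβ hβ₀ hpos hsum hE hgap _ =>
    hN₀ N hN s q lam E β' ν' (firstLevels s l) h₁ h₂
      (fun i j => (sub_le_self _ (hlam j).1).trans (hlam i).2) hβ hβ₀ hpos hsum hE hgap⟩
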